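/- Write $\hat f(\xi)=\int_{\mathbb{R}^2} f(x)e^{-2\pi i x\cdot\xi}\,dx$ and, for $t\in\mathbb{R}$, let $$e^{R_1t}f(x)=\int_{\mathbb{R}^2}\hat f(\xi)\,e^{2\pi i x\cdot\xi-it\frac{\xi_1}{|\xi|}}\,d\xi$$ be the semigroup generated on $\mathbb{R}^2$ by the Riesz transform $R_1$, the Fourier multiplier with symbol $-i\xi_1/|\xi|$. Let $\varphi:\mathbb{R}^2\to\mathbb{R}$ be a smooth function supported in an annulus $\{a\le|\xi|\le b\}$ with $0<a\le b<\infty$ and satisfying $\sum_{j\in\mathbb{Z}}\varphi(2^{-j}\xi)=1$ for all $\xi\neq 0$, let $P_j$ be the Littlewood–Paley projectors given by $\widehat{P_jf}(\xi)=\varphi(2^{-j}\xi)\hat f(\xi)$, and let $$\|f\|_{\dot B^{2}_{1,1}}=\sum_{j\in\mathbb{Z}}2^{2j}\,\|P_jf\|_{L^1(\mathbb{R}^2)}\in[0,\infty].$$ Then there is a constant $C>0$, depending only on $\varphi$, such that for every $f\in C_c^\infty(\mathbb{R}^2;\mathbb{C})$ and every $t>0$ $$\|e^{R_1t}f\|_{L^\infty(\mathbb{R}^2)}\le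 C\,t^{-1/2}\,\|f\|_{\dot B^{2}_{1,1}}.$$ -/

import Mathlib

open scoped FourierTransform ContDiff ENNReal

noncomputable section

/-- The Euclidean plane `ℝ²`. -/
abbrev Plane : Type := EuclideanSpace ℝ (Fin 2)

/-- The Fourier multiplier operator with symbol `m`: the inverse Fourier transform of `m · 𝓕 f`,
that is `x ↦ ∫ m(ξ) (𝓕 f)(ξ) e^{2πi x·ξ} dξ`, where `(𝓕 f)(ξ) = ∫ f(x) e^{-2πi x·ξ} dx`. -/
def multiplierOp (m : Plane → ℂ) (f : Plane → ℂ) : Plane → ℂ :=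
  𝓕⁻ (fun ξ => m ξ * 𝓕 f ξ)

/-- The symbol `-i ξ₁ / |ξ|` of the Riesz transform `R₁`. It is homogeneous of degree zero, so that
the operator does not depend on the factor `2π` in the normalization of the frequency variable. -/
def rieszSymbol (ξ : Plane) : ℂ :=
  -Complex.I * ((ξ 0 / ‖ξ‖ : ℝ) : ℂ)

/-- The semigroup `e^{R₁ t}`: the Fourier multiplier operator with symbol `e^{-i t ξ₁ / |ξ|}`. -/
def rieszSemigroup (t : ℝ) (f : Plane → ℂ) : Plane → ℂ :=
  multiplierOp (fun ξ => Complex.exp (t * rieszSymbol ξ)) f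

/-- `φ` generates a homogeneous Littlewood-Paley decomposition of `ℝ²`: it is smooth, supported in
an annulus, and its dyadic dilates form a partition of unity away from the origin. -/
structure IsLittlewoodPaley (φ : Plane → ℝ) : Prop where
  smooth : ContDiff ℝ ∞ φ
  annulus : ∃ a b : ℝ, 0 < a ∧ ∀ ξ, φ ξ ≠ 0 → a ≤ ‖ξ‖ ∧ ‖ξ‖ ≤ b
  sum_eq_one : ∀ ξ, ξ ≠ 0 → ∑' j : ℤ, φ ((2 : ℝ) ^ (-j) • ξ) = 1

/-- The Littlewood-Paley projector `P_j`, with symbol `φ(2^{-j} ξ)`. -/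
def lpProj (φ : Plane → ℝ) (j : ℤ) (f : Plane → ℂ) : Plane → ℂ :=
  multiplierOp (fun ξ => (φ ((2 : ℝ) ^ (-j) • ξ) : ℂ)) f

/-- The homogeneous Besov norm of `Ḃ^s_{p,q}` built from `φ`, with values in `[0, ∞]`: the `ℓ^q`
norm over `j ∈ ℤ` of `2^{js} ‖P_j f‖_{L^p}`. -/
def besovNorm (φ : Plane → ℝ) (s : ℝ) (p q : ℝ≥0∞) (f : Plane → ℂ) : ℝ≥0∞ :=
  MeasureTheory.eLpNorm
    (fun j : ℤ => ENNReal.ofReal ((2 : ℝ) ^ ((j : ℝ) * s)) *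
      MeasureTheory.eLpNorm (lpProj φ j f) p MeasureTheory.volume)
    q MeasureTheory.Measure.count

end

/-! The symbol has modulus one and is constant on rays, so decay in `t` comes only from oscillation
in the angle. Cut the kernel off to `|ξ| ≤ R` and pass to polar coordinates. The phase at radius `r`
is the inner product of `(cos θ, sin θ)` with `2πr x - t e₁`, so the angular integral is a Bessel
function `J₀` of the length of that vector, which is at least `|2πr|x| - t|`. The bound `|J₀(s)| ≲
s^(-1/2)` leaves a singularity that is integrable in `r`, and the radial integral is `O(R²
t^(-1/2))` uniformly in `x` (`norm_integral_closedBall_exp_le`). A function with Fourier support in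
that ball therefore obeys an `L¹ → L^∞` bound with this constant. For `P_j f` one takes `R ~ 2^j`,
so `R²` is the Besov weight `2^(2j)`, and the pieces are summed over `j`. -/

open MeasureTheory

/-! ### Angular oscillatory integrals -/

/-- Van der Corput estimate away from the stationary points of `cos`. -/
theorem norm_integral_exp_cos_interior_le {s δ : ℝ} (hs : 0 < s) (hδ : 0 < δ)
    (hδ' : δ ≤ Real.pi / 2) :
    ‖∫ θ in δ..(Real.pi - δ), Complex.exp (Complex.I * (s * Real.cos θ : ℝ))‖
      ≤ 2 * Real.pi / (s * δ) := by
  have hle : δ ≤ Real.pi - δ := by linarith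
  have hpos : ∀ θ ∈ Set.uIcc δ (Real.pi - δ), 0 < Real.sin θ := by
    intro θ hθ
    rw [Set.uIcc_of_le hle] at hθ
    exact Real.sin_pos_of_pos_of_lt_pi (by linarith [hθ.1]) (by linarith [hθ.2])
  set E : ℝ → ℂ := fun θ => Complex.exp (Complex.I * (s * Real.cos θ : ℝ)) with hE
  have hEn : ∀ θ, ‖E θ‖ = 1 := by
    intro θ
    simp only [hE]
    rw [mul_comm, Complex.norm_exp_ofReal_mul_I]
  -- Integration by parts: `E' = -i s sin θ E`, so `F = (i / (s sin θ)) E` has derivative `E + G`,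
  -- with `G` the term where `1 / sin` is differentiated.
  set F : ℝ → ℂ := fun θ => E θ * (Complex.I / s) * ((Real.sin θ)⁻¹ : ℝ) with hF
  set G : ℝ → ℂ := fun θ => E θ * (Complex.I / s) * (-Real.cos θ / Real.sin θ ^ 2 : ℝ) with hG
  have hsc : (s : ℂ) ≠ 0 := by exact_mod_cast hs.ne'
  have hder : ∀ θ ∈ Set.uIcc δ (Real.pi - δ), HasDerivAt F (E θ + G θ) θ := by
    intro θ hθ
    have h0 := hpos θ hθ
    have h1 : HasDerivAt E (E θ * (Complex.I * (s * (-Real.sin θ) : ℝ))) θ := by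
      have := (((Real.hasDerivAt_cos θ).const_mul s).ofReal_comp.const_mul Complex.I).cexp
      exact this
    have h2 : HasDerivAt (fun θ => (((Real.sin θ)⁻¹ : ℝ) : ℂ))
        ((-Real.cos θ / Real.sin θ ^ 2 : ℝ) : ℂ) θ :=
      ((Real.hasDerivAt_sin θ).inv h0.ne').ofReal_comp
    have h3 := (h1.mul_const (Complex.I / s)).mul h2
    refine h3.congr_deriv ?_
    simp only [hG]
    have h0c : (Real.sin θ : ℂ) ≠ 0 := by exact_mod_cast h0.ne'
    push_cast at h0c ⊢
    field_simp
    linear_combination (-(E θ * s * Complex.sin θ ^ 2)) * Complex.I_sq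
  have hEc : Continuous E := by simp only [hE]; fun_prop
  have hGc : ContinuousOn G (Set.uIcc δ (Real.pi - δ)) := by
    have : ContinuousOn (fun θ => -Real.cos θ / Real.sin θ ^ 2) (Set.uIcc δ (Real.pi - δ)) :=
      ContinuousOn.div (by fun_prop) (by fun_prop) fun θ hθ => (pow_pos (hpos θ hθ) 2).ne'
    exact (hEc.continuousOn.mul continuousOn_const).mul
      (Complex.continuous_ofReal.comp_continuousOn this)
  have hGi := hGc.intervalIntegrable (μ := volume)
  have hEi := hEc.intervalIntegrable (μ := volume) δ (Real.pi - δ)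
  have hFTC := intervalIntegral.integral_eq_sub_of_hasDerivAt hder (hEi.add hGi)
  rw [intervalIntegral.integral_add hEi hGi] at hFTC
  have hsd := hpos δ Set.left_mem_uIcc
  -- `|G| ≤ 1 / (s sin²)`, whose antiderivative is `-cot / s`.
  have hcot : ∀ θ ∈ Set.uIcc δ (Real.pi - δ),
      HasDerivAt (fun θ => -(Real.cos θ / Real.sin θ) / s) (1 / Real.sin θ ^ 2 / s) θ := by
    intro θ hθ
    have h0 := hpos θ hθ
    have := (((Real.hasDerivAt_cos θ).div (Real.hasDerivAt_sin θ) h0.ne').neg).div_const s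
    refine this.congr_deriv ?_
    have := Real.sin_sq_add_cos_sq θ
    field_simp
    linarith
  have hcoti : IntervalIntegrable (fun θ => 1 / Real.sin θ ^ 2 / s) volume δ (Real.pi - δ) := by
    apply ContinuousOn.intervalIntegrable
    exact (ContinuousOn.div (by fun_prop) (by fun_prop)
      fun θ hθ => (pow_pos (hpos θ hθ) 2).ne').div_const s
  have hGbound : ‖∫ θ in δ..(Real.pi - δ), G θ‖ ≤ 2 / (s * Real.sin δ) := by
    have h1 : ‖∫ θ in δ..(Real.pi - δ), G θ‖
        ≤ ∫ θ in δ..(Real.pi - δ), 1 / Real.sin θ ^ 2 / s := by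
      refine intervalIntegral.norm_integral_le_of_norm_le hle ?_ hcoti
      filter_upwards with θ hθ
      have h0 := hpos θ (by rw [Set.uIcc_of_le hle]; exact ⟨hθ.1.le, hθ.2⟩)
      simp only [hG, norm_mul, hEn, norm_div, Complex.norm_I, Complex.norm_real, Real.norm_eq_abs,
        abs_of_pos hs, abs_neg, abs_of_pos (pow_pos h0 2)]
      have := Real.abs_cos_le_one θ
      calc 1 * (1 / s) * (|Real.cos θ| / Real.sin θ ^ 2)
          ≤ 1 * (1 / s) * (1 / Real.sin θ ^ 2) := by gcongr
        _ = _ := by ring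
    refine h1.trans ?_
    rw [intervalIntegral.integral_eq_sub_of_hasDerivAt hcot hcoti, Real.sin_pi_sub,
      Real.cos_pi_sub]
    have := Real.cos_le_one δ
    have e : -(-Real.cos δ / Real.sin δ) / s - -(Real.cos δ / Real.sin δ) / s
        = 2 * Real.cos δ / (s * Real.sin δ) := by field_simp; ring
    rw [e]
    gcongr
    linarith
  have hFn : ∀ θ, 0 < Real.sin θ → ‖F θ‖ = 1 / (s * Real.sin θ) := by
    intro θ h0
    simp only [hF, norm_mul, hEn, norm_div, Complex.norm_I, Complex.norm_real, Real.norm_eq_abs,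
        abs_of_pos hs, abs_inv, abs_of_pos h0]
    field_simp
  have e : (∫ θ in δ..(Real.pi - δ), E θ)
      = F (Real.pi - δ) - F δ - ∫ θ in δ..(Real.pi - δ), G θ := by
    rw [← hFTC]; ring
  rw [e]
  have h1 := hFn δ hsd
  have h2 := hFn (Real.pi - δ) (by rwa [Real.sin_pi_sub])
  rw [Real.sin_pi_sub] at h2
  have hsin : 2 / Real.pi * δ ≤ Real.sin δ := Real.mul_le_sin hδ.le hδ'
  calc _ ≤ ‖F (Real.pi - δ)‖ + ‖F δ‖ + ‖∫ θ in δ..(Real.pi - δ), G θ‖ :=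
        (norm_sub_le _ _).trans (add_le_add_left (norm_sub_le _ _) _)
    _ ≤ 1 / (s * Real.sin δ) + 1 / (s * Real.sin δ) + 2 / (s * Real.sin δ) := by
        rw [h1, h2]; gcongr
    _ = 4 / (s * Real.sin δ) := by ring
    _ ≤ 4 / (s * (2 / Real.pi * δ)) := by
        have := Real.pi_pos
        gcongr
    _ = _ := by
        have := Real.pi_pos
        field_simp
        norm_num

/-- The decay of the Bessel function `J₀`. -/
theorem norm_integral_exp_cos_le {s : ℝ} (hs : 0 < s) :
    ‖∫ θ in (-Real.pi)..Real.pi, Complex.exp (Complex.I * (s * Real.cos θ : ℝ))‖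
      ≤ 20 * s ^ (-(1 / 2) : ℝ) := by
  have hpi := Real.pi_pos
  have hpi4 := Real.pi_lt_four
  have hpi3 := Real.pi_lt_d2
  have hsq : 0 < √s := Real.sqrt_pos.2 hs
  have hrw : s ^ (-(1 / 2) : ℝ) = (√s)⁻¹ := by
    rw [Real.rpow_neg hs.le, Real.sqrt_eq_rpow]
  rw [hrw]
  set E : ℝ → ℂ := fun θ => Complex.exp (Complex.I * (s * Real.cos θ : ℝ)) with hE
  have hEn : ∀ θ, ‖E θ‖ ≤ 1 := by
    intro θ
    simp only [hE]
    rw [mul_comm, Complex.norm_exp_ofReal_mul_I]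
  have hEc : Continuous E := by simp only [hE]; fun_prop
  have hEi : ∀ a b, IntervalIntegrable E volume a b := fun a b => hEc.intervalIntegrable a b
  have htriv : ∀ a b, ‖∫ θ in a..b, E θ‖ ≤ |b - a| := fun a b => by
    simpa using intervalIntegral.norm_integral_le_of_norm_le_const (a := a) (b := b)
      (f := E) (C := 1) fun θ _ => hEn θ
  -- The choice `δ = s^(-1/2)` balances the trivial bound `δ` at each end with `2π / (s δ) = 2π δ`
  -- in the middle. Evenness doubles the bound `10 δ` on `[0, π]`. If `δ > π / 2`, the trivial bound
  -- `2π` suffices.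
  by_cases hδ' : (√s)⁻¹ ≤ Real.pi / 2
  · set δ := (√s)⁻¹ with hδdef
    have hδ : 0 < δ := inv_pos.2 hsq
    have hmid := norm_integral_exp_cos_interior_le hs hδ hδ'
    have hsδ : 2 * Real.pi / (s * δ) = 2 * Real.pi * δ := by
      have : s = √s * √s := (Real.mul_self_sqrt hs.le).symm
      rw [hδdef]
      nth_rewrite 1 [this]
      field_simp
    rw [hsδ] at hmid
    have h0 : ‖∫ θ in (0 : ℝ)..Real.pi, E θ‖ ≤ 10 * δ := by
      have e : (∫ θ in (0 : ℝ)..Real.pi, E θ) = (∫ θ in (0 : ℝ)..δ, E θ)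
          + (∫ θ in δ..(Real.pi - δ), E θ) + ∫ θ in (Real.pi - δ)..Real.pi, E θ := by
        rw [intervalIntegral.integral_add_adjacent_intervals (hEi _ _) (hEi _ _),
          intervalIntegral.integral_add_adjacent_intervals (hEi _ _) (hEi _ _)]
      rw [e]
      have h1 := htriv 0 δ
      have h2 := htriv (Real.pi - δ) Real.pi
      rw [sub_zero, abs_of_pos hδ] at h1
      rw [sub_sub_cancel, abs_of_pos hδ] at h2
      have := norm_add₃_le (a := ∫ θ in (0 : ℝ)..δ, E θ) (b := ∫ θ in δ..(Real.pi - δ), E θ)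
        (c := ∫ θ in (Real.pi - δ)..Real.pi, E θ)
      nlinarith
    have hneg : (∫ θ in (-Real.pi)..0, E θ) = ∫ θ in (0 : ℝ)..Real.pi, E θ := by
      have := intervalIntegral.integral_comp_neg (a := 0) (b := Real.pi) E
      rw [neg_zero] at this
      rw [← this]
      simp [hE]
    rw [← intervalIntegral.integral_add_adjacent_intervals (hEi _ 0) (hEi 0 _), hneg]
    refine (norm_add_le _ _).trans ?_
    linarith
  · have := htriv (-Real.pi) Real.pi
    rw [abs_of_pos (by linarith)] at this
    push Not at hδ'
    linarith

/-- The phase is `‖z‖ cos (θ - arg z)` with `z = v + i w`, and periodicity absorbs the shift. The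
bound is in terms of any `s ≤ ‖z‖` because the application only controls `‖z‖` from below. -/
theorem norm_integral_exp_cos_add_sin_le {v w s : ℝ} (hs : 0 < s) (hvw : s ≤ ‖(⟨v, w⟩ : ℂ)‖) :
    ‖∫ θ in (-Real.pi)..Real.pi,
        Complex.exp (Complex.I * (v * Real.cos θ + w * Real.sin θ : ℝ))‖
      ≤ 20 * s ^ (-(1 / 2) : ℝ) := by
  set z : ℂ := ⟨v, w⟩ with hz
  have hzpos : 0 < ‖z‖ := hs.trans_le hvw
  have hv : v = ‖z‖ * Real.cos z.arg := (Complex.norm_mul_cos_arg z).symm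
  have hw : w = ‖z‖ * Real.sin z.arg := (Complex.norm_mul_sin_arg z).symm
  set E : ℝ → ℂ := fun θ => Complex.exp (Complex.I * (‖z‖ * Real.cos θ : ℝ)) with hE
  have hper : Function.Periodic E (2 * Real.pi) := fun θ => by
    simp only [hE, Real.cos_add_two_pi]
  have key : (∫ θ in (-Real.pi)..Real.pi,
        Complex.exp (Complex.I * (v * Real.cos θ + w * Real.sin θ : ℝ)))
      = ∫ θ in (-Real.pi)..Real.pi, E θ := by
    have h1 : ∀ θ, Complex.exp (Complex.I * (v * Real.cos θ + w * Real.sin θ : ℝ))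
        = E (θ - z.arg) := by
      intro θ
      simp only [hE, Real.cos_sub]
      congr 3
      rw [mul_add]
      nth_rewrite 1 [hv]
      nth_rewrite 1 [hw]
      ring
    simp_rw [h1]
    rw [intervalIntegral.integral_comp_sub_right]
    have := hper.intervalIntegral_add_eq (-Real.pi - z.arg) (-Real.pi)
    convert this using 2 <;> ring
  rw [key]
  refine (norm_integral_exp_cos_le hzpos).trans ?_
  have := Real.rpow_le_rpow_of_nonpos hs hvw (z := -(1 / 2)) (by norm_num)
  linarith

/-! ### Radial integrals of the inverse square root singularity -/

theorem lintegral_abs_rpow_neg_half_le {R : ℝ} (hR : 0 < R) :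
    ∫⁻ s in Set.Icc (-R) R, ENNReal.ofReal (|s| ^ (-(1 / 2) : ℝ)) ≤ ENNReal.ofReal (4 * √R) := by
  have hi : IntegrableOn (fun s : ℝ => s ^ (-(1 / 2) : ℝ)) (Set.Icc 0 R) := by
    rw [integrableOn_Icc_iff_integrableOn_Ioc, ← intervalIntegrable_iff_integrableOn_Ioc_of_le hR.le]
    exact intervalIntegral.intervalIntegrable_rpow' (by norm_num)
  have hI : ∫ s in Set.Icc 0 R, s ^ (-(1 / 2) : ℝ) = 2 * √R := by
    rw [integral_Icc_eq_integral_Ioc, ← intervalIntegral.integral_of_le hR.le,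
      integral_rpow (Or.inl (by norm_num)), Real.sqrt_eq_rpow]
    norm_num
    ring
  have hpos : ∫⁻ s in Set.Icc 0 R, ENNReal.ofReal (|s| ^ (-(1 / 2) : ℝ))
      = ENNReal.ofReal (2 * √R) := by
    rw [← hI, ofReal_integral_eq_lintegral_ofReal hi]
    · refine setLIntegral_congr_fun measurableSet_Icc fun s hs => ?_
      simp only [abs_of_nonneg hs.1]
    · filter_upwards [ae_restrict_mem measurableSet_Icc] with s hs
      exact Real.rpow_nonneg hs.1 _
  have hneg : ∫⁻ s in Set.Icc (-R) 0, ENNReal.ofReal (|s| ^ (-(1 / 2) : ℝ))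
      = ENNReal.ofReal (2 * √R) := by
    rw [← hpos, ← (Measure.measurePreserving_neg (volume : Measure ℝ)).setLIntegral_comp_preimage_emb
      (MeasurableEquiv.neg ℝ).measurableEmbedding]
    simp
  calc _ ≤ ∫⁻ s in Set.Icc (-R) 0 ∪ Set.Icc 0 R, ENNReal.ofReal (|s| ^ (-(1 / 2) : ℝ)) :=
        lintegral_mono_set (by rw [Set.Icc_union_Icc_eq_Icc (by linarith) hR.le])
    _ ≤ _ := lintegral_union_le _ _ _
    _ = _ := by
        rw [hpos, hneg, ← ENNReal.ofReal_add (by positivity) (by positivity)]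
        ring_nf

/-- Points within `R` of `c` contribute at most `4√R` by translation; elsewhere the integrand is at
most `R^(-1/2)`, contributing at most `√R`. -/
theorem lintegral_abs_sub_rpow_neg_half_le {R : ℝ} (hR : 0 < R) (c : ℝ) :
    ∫⁻ s in Set.Ioc 0 R, ENNReal.ofReal (|s - c| ^ (-(1 / 2) : ℝ)) ≤ ENNReal.ofReal (5 * √R) := by
  set h : ℝ → ℝ≥0∞ := (Set.Icc (-R) R).indicator fun s => ENNReal.ofReal (|s| ^ (-(1 / 2) : ℝ))
  have hm : Measurable h := by
    refine Measurable.indicator ?_ measurableSet_Icc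
    fun_prop
  have hb : ∀ s, ENNReal.ofReal (|s - c| ^ (-(1 / 2) : ℝ))
      ≤ h (s - c) + ENNReal.ofReal (R ^ (-(1 / 2) : ℝ)) := by
    intro s
    by_cases hs : s - c ∈ Set.Icc (-R) R
    · simp only [h, Set.indicator_of_mem hs]
      exact le_self_add
    · have : R ≤ |s - c| := by
        by_contra hcon
        push Not at hcon
        exact hs (abs_le.1 hcon.le)
      refine le_trans (ENNReal.ofReal_le_ofReal ?_) le_add_self
      exact Real.rpow_le_rpow_of_nonpos hR this (by norm_num)
  calc _ ≤ ∫⁻ s in Set.Ioc 0 R, (h (s - c) + ENNReal.ofReal (R ^ (-(1 / 2) : ℝ))) :=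
        lintegral_mono fun s => hb s
    _ = (∫⁻ s in Set.Ioc 0 R, h (s - c)) + ENNReal.ofReal (R ^ (-(1 / 2) : ℝ)) * ENNReal.ofReal R := by
        rw [lintegral_add_right _ measurable_const, setLIntegral_const, Real.volume_Ioc, sub_zero]
    _ ≤ (∫⁻ s, h (s - c)) + ENNReal.ofReal (√R) := by
        gcongr
        · exact Measure.restrict_le_self
        · rw [← ENNReal.ofReal_mul (by positivity)]
          refine ENNReal.ofReal_le_ofReal (le_of_eq ?_)
          rw [Real.rpow_neg hR.le, ← Real.sqrt_eq_rpow]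
          have := Real.mul_self_sqrt hR.le
          field_simp
          nlinarith
    _ ≤ ENNReal.ofReal (4 * √R) + ENNReal.ofReal (√R) := by
        rw [lintegral_sub_right_eq_self, lintegral_indicator measurableSet_Icc]
        gcongr
        exact lintegral_abs_rpow_neg_half_le hR
    _ = _ := by
        rw [← ENNReal.ofReal_add (by positivity) (by positivity)]
        ring_nf

/-- Uniformity in `q` is the point. If `q R ≤ t / 2`, then `|q s - t| ≥ t / 2` throughout. Otherwise
`q ≥ t / (2R)`, and scaling out `q^(-1/2)` gives the decay in `t`, with constant `5√2 ≤ 8`. -/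
theorem lintegral_abs_mul_sub_rpow_neg_half_le {R q t : ℝ} (hR : 0 < R) (hq : 0 ≤ q) (ht : 0 < t) :
    ∫⁻ s in Set.Ioc 0 R, ENNReal.ofReal (|q * s - t| ^ (-(1 / 2) : ℝ))
      ≤ ENNReal.ofReal (8 * R * t ^ (-(1 / 2) : ℝ)) := by
  have hsqrt2 : √2 ≤ 1.5 := by
    rw [Real.sqrt_le_left (by norm_num)]; norm_num
  have hrp : ∀ a : ℝ, 0 ≤ a → a ^ (-(1 / 2) : ℝ) = (√a)⁻¹ := fun a ha => by
    rw [Real.rpow_neg ha, Real.sqrt_eq_rpow]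
  have htp : 0 < √t := Real.sqrt_pos.2 ht
  have ht2 : (t / 2) ^ (-(1 / 2) : ℝ) = √2 * (√t)⁻¹ := by
    rw [hrp _ (by positivity), Real.sqrt_div ht.le, inv_div]
    rfl
  by_cases hqR : q * R ≤ t / 2
  · calc _ ≤ ∫⁻ s in Set.Ioc 0 R, ENNReal.ofReal ((t / 2) ^ (-(1 / 2) : ℝ)) := by
          refine setLIntegral_mono measurable_const fun s hs => ENNReal.ofReal_le_ofReal ?_
          refine Real.rpow_le_rpow_of_nonpos (by positivity) ?_ (by norm_num)
          have : q * s ≤ q * R := mul_le_mul_of_nonneg_left hs.2 hq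
          rw [abs_sub_comm]
          exact le_trans (by linarith) (le_abs_self _)
      _ ≤ _ := by
          rw [setLIntegral_const, Real.volume_Ioc, sub_zero, ← ENNReal.ofReal_mul (by positivity)]
          refine ENNReal.ofReal_le_ofReal ?_
          rw [ht2, hrp t ht.le]
          have : 0 < (√t)⁻¹ * R := by positivity
          nlinarith
  · push Not at hqR
    have hq0 : 0 < q := by
      by_contra h0
      have : q = 0 := le_antisymm (not_lt.1 h0) hq
      rw [this] at hqR
      linarith
    have hqt : t / 2 / R ≤ q := by
      rw [div_le_iff₀ hR]; exact hqR.le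
    have e : ∀ s, ENNReal.ofReal (|q * s - t| ^ (-(1 / 2) : ℝ))
        = ENNReal.ofReal (q ^ (-(1 / 2) : ℝ)) * ENNReal.ofReal (|s - t / q| ^ (-(1 / 2) : ℝ)) := by
      intro s
      rw [← ENNReal.ofReal_mul (by positivity), ← Real.mul_rpow hq (abs_nonneg _)]
      congr 2
      rw [← abs_of_pos hq0, ← abs_mul, abs_of_pos hq0]
      congr 1
      field_simp
    simp_rw [e]
    rw [lintegral_const_mul _ (by fun_prop)]
    calc _ ≤ ENNReal.ofReal (q ^ (-(1 / 2) : ℝ)) * ENNReal.ofReal (5 * √R) := by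
          gcongr
          exact lintegral_abs_sub_rpow_neg_half_le hR _
      _ ≤ _ := by
          rw [← ENNReal.ofReal_mul (by positivity)]
          refine ENNReal.ofReal_le_ofReal ?_
          have h1 : q ^ (-(1 / 2) : ℝ) ≤ (t / 2 / R) ^ (-(1 / 2) : ℝ) :=
            Real.rpow_le_rpow_of_nonpos (by positivity) hqt (by norm_num)
          have h2 : (t / 2 / R) ^ (-(1 / 2) : ℝ) = √2 * (√t)⁻¹ * √R := by
            rw [Real.div_rpow (by positivity) hR.le, ht2, hrp R hR.le, div_inv_eq_mul]
          rw [hrp t ht.le]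
          have h3 := Real.mul_self_sqrt hR.le
          calc q ^ (-(1 / 2) : ℝ) * (5 * √R) ≤ √2 * (√t)⁻¹ * √R * (5 * √R) := by
                rw [← h2]; gcongr
            _ = 5 * √2 * (√t)⁻¹ * (√R * √R) := by ring
            _ = 5 * √2 * ((√t)⁻¹ * R) := by rw [h3]; ring
            _ ≤ 8 * ((√t)⁻¹ * R) := by gcongr; linarith
            _ = _ := by ring

/-! ### Kernel estimate in polar coordinates -/

theorem integral_closedBall_eq_integral_polar {E : Type*} [NormedAddCommGroup E] [NormedSpace ℝ E]
    (F : Plane → E) (R : ℝ) :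
    ∫ ξ in Metric.closedBall 0 R, F ξ
      = ∫ p in Set.Ioc 0 R ×ˢ Set.Ioo (-Real.pi) Real.pi,
          p.1 • F !₂[p.1 * Real.cos p.2, p.1 * Real.sin p.2] := by
  have hpolar : ∀ p : ℝ × ℝ, Complex.orthonormalBasisOneI.repr (Complex.polarCoord.symm p)
      = !₂[p.1 * Real.cos p.2, p.1 * Real.sin p.2] := by
    intro p
    ext i
    rw [Complex.orthonormalBasisOneI_repr_apply]
    fin_cases i
    · simp [-Complex.ofReal_cos]
    · simp [-Complex.ofReal_sin]
  rw [← integral_indicator Metric.isClosed_closedBall.measurableSet,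
    ← Complex.orthonormalBasisOneI.repr.measurePreserving.integral_comp
      Complex.orthonormalBasisOneI.repr.toHomeomorph.measurableEmbedding,
    ← Complex.integral_comp_polarCoord_symm]
  have hsub : Set.Ioc 0 R ×ˢ Set.Ioo (-Real.pi) Real.pi ⊆ polarCoord.target := by
    rw [polarCoord_target]
    exact Set.prod_mono Set.Ioc_subset_Ioi_self subset_rfl
  have hms : MeasurableSet (Set.Ioc 0 R ×ˢ Set.Ioo (-Real.pi) Real.pi) :=
    measurableSet_Ioc.prod measurableSet_Ioo
  rw [← Set.inter_eq_self_of_subset_right hsub, ← setIntegral_indicator hms]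
  refine setIntegral_congr_fun polarCoord.open_target.measurableSet fun p hp => ?_
  rw [polarCoord_target] at hp
  have hn : ‖Complex.orthonormalBasisOneI.repr (Complex.polarCoord.symm p)‖ = p.1 := by
    rw [LinearIsometryEquiv.norm_map, Complex.norm_polarCoord_symm, abs_of_pos hp.1]
  by_cases h : p.1 ≤ R
  · rw [Set.indicator_of_mem (by rwa [mem_closedBall_zero_iff, hn]),
      Set.indicator_of_mem (show p ∈ Set.Ioc 0 R ×ˢ Set.Ioo (-Real.pi) Real.pi from ⟨⟨hp.1, h⟩, hp.2⟩), hpolar]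
  · rw [Set.indicator_of_notMem (by rwa [mem_closedBall_zero_iff, hn]),
      Set.indicator_of_notMem (fun h' => h h'.1.2), smul_zero]

/-- Dispersive estimate for the kernel of the semigroup localized to frequencies `|ξ| ≤ R`. -/
theorem norm_integral_closedBall_exp_le {R t : ℝ} (hR : 0 < R) (ht : 0 < t) (x : Plane) :
    ‖∫ ξ in Metric.closedBall (0 : Plane) R,
        Complex.exp (Complex.I * (2 * Real.pi * inner ℝ ξ x - t * (ξ 0 / ‖ξ‖) : ℝ))‖
      ≤ 160 * R ^ 2 * t ^ (-(1 / 2) : ℝ) := by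
  set J : ℝ → ℝ → ℂ := fun r θ => Complex.exp (Complex.I *
    ((2 * Real.pi * r * x 0 - t) * Real.cos θ + (2 * Real.pi * r * x 1) * Real.sin θ : ℝ)) with hJ
  have h1 : ∫ ξ in Metric.closedBall (0 : Plane) R,
        Complex.exp (Complex.I * (2 * Real.pi * inner ℝ ξ x - t * (ξ 0 / ‖ξ‖) : ℝ))
      = ∫ p in Set.Ioc 0 R ×ˢ Set.Ioo (-Real.pi) Real.pi, p.1 • J p.1 p.2 := by
    rw [integral_closedBall_eq_integral_polar]
    refine setIntegral_congr_fun (measurableSet_Ioc.prod measurableSet_Ioo) fun p hp => ?_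
    have hp0 : 0 < p.1 := hp.1.1
    have hn : ‖(!₂[p.1 * Real.cos p.2, p.1 * Real.sin p.2] : Plane)‖ = p.1 := by
      rw [EuclideanSpace.norm_eq, Real.sqrt_eq_iff_mul_self_eq (by positivity) hp0.le]
      simp only [Fin.sum_univ_two, Real.norm_eq_abs, sq_abs]
      simp only [Matrix.cons_val_zero, Matrix.cons_val_one]
      linear_combination p.1 ^ 2 * Real.sin_sq_add_cos_sq p.2
    simp only [hJ]
    congr 4
    rw [hn]
    simp only [PiLp.inner_apply, Fin.sum_univ_two, Matrix.cons_val_zero,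
      Matrix.cons_val_one, RCLike.inner_apply, conj_trivial]
    field_simp
    ring
  have hJc : Continuous fun p : ℝ × ℝ => p.1 • J p.1 p.2 := by
    simp only [hJ]; fun_prop
  have hJi : IntegrableOn (fun p : ℝ × ℝ => p.1 • J p.1 p.2)
      (Set.Ioc 0 R ×ˢ Set.Ioo (-Real.pi) Real.pi) (volume.prod volume) :=
    (hJc.continuousOn.integrableOn_compact (isCompact_Icc.prod isCompact_Icc)).mono_set
      (Set.prod_mono Set.Ioc_subset_Icc_self Set.Ioo_subset_Icc_self)
  rw [h1, Measure.volume_eq_prod, setIntegral_prod _ hJi]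
  set q : ℝ := 2 * Real.pi * ‖(⟨x 0, x 1⟩ : ℂ)‖ with hq
  have hpi := Real.pi_pos
  have hq0 : 0 ≤ q := by positivity
  -- The radius `r = t / q`, where the lower bound `|q r - t|` vanishes, is a null set.
  have hbound : ∀ᵐ r ∂(volume.restrict (Set.Ioc 0 R)),
      ‖∫ θ in Set.Ioo (-Real.pi) Real.pi, r • J r θ‖ₑ
        ≤ ENNReal.ofReal (20 * R) * ENNReal.ofReal (|q * r - t| ^ (-(1 / 2) : ℝ)) := by
    filter_upwards [ae_restrict_mem measurableSet_Ioc,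
      ae_restrict_of_ae (Measure.ae_ne volume (t / q))] with r hr hne
    have hs : 0 < |q * r - t| := by
      rw [abs_pos]
      intro h0
      have hq1 : q ≠ 0 := by
        rintro h
        rw [h] at h0
        linarith
      apply hne
      field_simp
      linarith
    -- Reverse triangle inequality for `2πr x - t e₁`.
    have hz : |q * r - t| ≤ ‖(⟨2 * Real.pi * r * x 0 - t, 2 * Real.pi * r * x 1⟩ : ℂ)‖ := by
      have e : (⟨2 * Real.pi * r * x 0 - t, 2 * Real.pi * r * x 1⟩ : ℂ)
          = ((2 * Real.pi * r : ℝ) : ℂ) * ⟨x 0, x 1⟩ - (t : ℂ) := by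
        apply Complex.ext <;> simp
      have e1 : q * r = ‖((2 * Real.pi * r : ℝ) : ℂ) * ⟨x 0, x 1⟩‖ := by
        rw [norm_mul, Complex.norm_real, Real.norm_eq_abs,
          abs_of_nonneg (by have := hr.1; positivity), hq]
        ring
      have e2 : t = ‖(t : ℂ)‖ := by
        rw [Complex.norm_real, Real.norm_eq_abs, abs_of_pos ht]
      rw [e, e1]
      nth_rewrite 1 [e2]
      exact abs_norm_sub_norm_le _ _
    have hb := norm_integral_exp_cos_add_sin_le hs hz
    rw [integral_smul, ← integral_Ioc_eq_integral_Ioo,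
      ← intervalIntegral.integral_of_le (by linarith), ← ENNReal.ofReal_mul (by positivity),
      ← ofReal_norm, norm_smul, Real.norm_eq_abs, abs_of_pos hr.1]
    refine ENNReal.ofReal_le_ofReal ?_
    calc _ ≤ R * (20 * |q * r - t| ^ (-(1 / 2) : ℝ)) := by
          gcongr
          exact hr.2
      _ = _ := by ring
  have hfin : ‖∫ r in Set.Ioc 0 R, ∫ θ in Set.Ioo (-Real.pi) Real.pi, r • J r θ‖ₑ
      ≤ ENNReal.ofReal (160 * R ^ 2 * t ^ (-(1 / 2) : ℝ)) := by
    refine (enorm_integral_le_lintegral_enorm _).trans ?_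
    refine (lintegral_mono_ae hbound).trans ?_
    rw [lintegral_const_mul _ (by fun_prop)]
    calc _ ≤ ENNReal.ofReal (20 * R) * ENNReal.ofReal (8 * R * t ^ (-(1 / 2) : ℝ)) := by
          gcongr
          exact lintegral_abs_mul_sub_rpow_neg_half_le hR hq0 ht
      _ = _ := by
          rw [← ENNReal.ofReal_mul (by positivity)]
          ring_nf
  rw [← ofReal_norm] at hfin
  exact (ENNReal.ofReal_le_ofReal_iff (by positivity)).1 hfin

/-! ### Frequency-localized estimate -/

theorem measurable_exp_rieszSymbol (t : ℝ) :
    Measurable fun ξ : Plane => Complex.exp (t * rieszSymbol ξ) := by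
  unfold rieszSymbol
  fun_prop

theorem exp_rieszSymbol (t : ℝ) (ξ : Plane) :
    Complex.exp (t * rieszSymbol ξ) = Complex.exp ((-(t * (ξ 0 / ‖ξ‖)) : ℝ) * Complex.I) := by
  unfold rieszSymbol
  congr 1
  push_cast
  ring

theorem norm_exp_rieszSymbol (t : ℝ) (ξ : Plane) : ‖Complex.exp (t * rieszSymbol ξ)‖ = 1 := by
  rw [exp_rieszSymbol, Complex.norm_exp_ofReal_mul_I]

/-- The Fourier support of `g` allows a sharp cutoff `h` of the symbol. Moving the Fourier transform
from `g` to `h` gives `∫ g(y) K(x - y) dy`, and only the supremum of `K` is needed, so the cutoff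
need not be smooth. -/
theorem norm_rieszSemigroup_le_of_fourier_support {R t : ℝ} (hR : 0 < R) (ht : 0 < t) {g : Plane → ℂ}
    (hg : Integrable g) (hsupp : ∀ ξ, 𝓕 g ξ ≠ 0 → ‖ξ‖ ≤ R) (x : Plane) :
    ‖rieszSemigroup t g x‖ ≤ 160 * R ^ 2 * t ^ (-(1 / 2) : ℝ) * ∫ y, ‖g y‖ := by
  set m : Plane → ℂ := fun ξ => Complex.exp (t * rieszSymbol ξ) with hm
  set h : Plane → ℂ := (Metric.closedBall (0 : Plane) R).indicator
    fun ξ => Complex.exp ((2 * Real.pi * inner ℝ ξ x : ℝ) * Complex.I) * m ξ with hh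
  have hmeas : MeasurableSet (Metric.closedBall (0 : Plane) R) :=
    Metric.isClosed_closedBall.measurableSet
  have hhi : Integrable h := by
    rw [hh, integrable_indicator_iff hmeas]
    refine IntegrableOn.of_bound (C := 1) measure_closedBall_lt_top ?_ ?_
    · refine Measurable.aestronglyMeasurable ?_
      exact Measurable.mul (by fun_prop) (measurable_exp_rieszSymbol t)
    · filter_upwards with ξ
      rw [norm_mul, Complex.norm_exp_ofReal_mul_I, norm_exp_rieszSymbol, one_mul]
  have hflip : ∫ ξ, 𝓕 g ξ • h ξ = ∫ y, g y • 𝓕 h y := by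
    simpa using! VectorFourier.integral_fourierIntegral_smul_eq_flip (L := innerₗ Plane)
      Real.continuous_fourierChar continuous_inner hg hhi
  have hleft : rieszSemigroup t g x = ∫ ξ, 𝓕 g ξ • h ξ := by
    unfold rieszSemigroup multiplierOp
    rw [Real.fourierInv_eq']
    refine integral_congr_ae (.of_forall fun ξ => ?_)
    simp only [hh, smul_eq_mul]
    by_cases h0 : 𝓕 g ξ = 0
    · simp [h0]
    · rw [Set.indicator_of_mem (by rw [mem_closedBall_zero_iff]; exact hsupp ξ h0)]
      ring
  have hk : ∀ y, ‖𝓕 h y‖ ≤ 160 * R ^ 2 * t ^ (-(1 / 2) : ℝ) := by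
    intro y
    refine le_trans (le_of_eq ?_) (norm_integral_closedBall_exp_le hR ht (x - y))
    rw [Real.fourier_eq', ← integral_indicator hmeas]
    congr 2
    ext ξ
    by_cases hξ : ξ ∈ Metric.closedBall (0 : Plane) R
    · simp only [hh, Set.indicator_of_mem hξ, smul_eq_mul, hm, exp_rieszSymbol]
      rw [← Complex.exp_add, ← Complex.exp_add, inner_sub_right]
      congr 1
      push_cast
      ring
    · simp [hh, Set.indicator_of_notMem hξ]
  rw [hleft, hflip, ← integral_const_mul]
  refine norm_integral_le_of_norm_le (hg.norm.const_mul _) (.of_forall fun y => ?_)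
  rw [norm_smul, mul_comm]
  gcongr
  exact hk y

/-! ### Littlewood–Paley decomposition -/

namespace IsLittlewoodPaley

variable {φ : Plane → ℝ}

theorem hasCompactSupport (hφ : IsLittlewoodPaley φ) : HasCompactSupport φ := by
  obtain ⟨a, b, -, hab⟩ := hφ.annulus
  refine HasCompactSupport.of_support_subset_isCompact (isCompact_closedBall 0 b) fun ξ hξ => ?_
  rw [mem_closedBall_zero_iff]
  exact (hab ξ hξ).2

theorem norm_smul_two_zpow (j : ℤ) (ξ : Plane) :
    ‖(2 : ℝ) ^ (-j) • ξ‖ = (2 : ℝ) ^ (-j) * ‖ξ‖ := by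
  rw [norm_smul, Real.norm_eq_abs, abs_of_pos (by positivity)]

/-- The dyadic dilates of `φ` have finite overlap. -/
theorem exists_tsum_enorm_le (hφ : IsLittlewoodPaley φ) :
    ∃ M : ℝ≥0∞, M ≠ ⊤ ∧ ∀ ξ, ∑' j : ℤ, ‖φ ((2 : ℝ) ^ (-j) • ξ)‖ₑ ≤ M := by
  obtain ⟨a, b, ha, hab⟩ := hφ.annulus
  obtain ⟨B, hB⟩ := hφ.hasCompactSupport.exists_bound_of_continuous hφ.smooth.continuous
  obtain ⟨n, hn⟩ := pow_unbounded_of_one_lt (b / a) (one_lt_two (α := ℝ))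
  rw [div_lt_iff₀ ha] at hn
  -- Since `2^n > b / a`, two dilates that are nonzero at the same `ξ` have indices at most `n`
  -- apart, so at most `2n + 1` are nonzero there.
  have hdiff : ∀ ξ (i j : ℤ), φ ((2 : ℝ) ^ (-i) • ξ) ≠ 0 → φ ((2 : ℝ) ^ (-j) • ξ) ≠ 0 →
      j ≤ i + n := by
    intro ξ i j hi hj
    have h1 := (hab _ hi).2
    have h2 := (hab _ hj).1
    rw [norm_smul_two_zpow] at h1 h2
    have e : (2 : ℝ) ^ (-i) = 2 ^ (j - i) * 2 ^ (-j) := by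
      rw [← zpow_add₀ two_ne_zero]
      congr 1
      ring
    have h3 : (2 : ℝ) ^ (j - i) * a < 2 ^ (n : ℤ) * a := by
      calc (2 : ℝ) ^ (j - i) * a ≤ 2 ^ (j - i) * (2 ^ (-j) * ‖ξ‖) := by gcongr
        _ = 2 ^ (-i) * ‖ξ‖ := by rw [e]; ring
        _ ≤ b := h1
        _ < _ := by rwa [zpow_natCast]
    have h4 := (zpow_lt_zpow_iff_right₀ (one_lt_two (α := ℝ))).1 (lt_of_mul_lt_mul_right h3 ha.le)
    linarith
  refine ⟨(2 * n + 1 : ℕ) * ENNReal.ofReal B,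
    ENNReal.mul_ne_top (ENNReal.natCast_ne_top _) ENNReal.ofReal_ne_top, fun ξ => ?_⟩
  by_cases hex : ∃ i : ℤ, φ ((2 : ℝ) ^ (-i) • ξ) ≠ 0
  · obtain ⟨i, hi⟩ := hex
    rw [tsum_eq_sum (s := Finset.Icc (i - n) (i + n))]
    · refine (Finset.sum_le_card_nsmul _ _ (ENNReal.ofReal B) fun j _ => ?_).trans ?_
      · rw [← ofReal_norm]
        exact ENNReal.ofReal_le_ofReal (hB _)
      · rw [Int.card_Icc, nsmul_eq_mul]
        gcongr
        omega
    · intro j hj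
      by_contra h0
      have hj0 : φ ((2 : ℝ) ^ (-j) • ξ) ≠ 0 := fun h => h0 (by rw [h, enorm_zero])
      have h1 := hdiff ξ i j hi hj0
      have h2 := hdiff ξ j i hj0 hi
      exact hj (Finset.mem_Icc.2 ⟨by linarith, h1⟩)
  · push Not at hex
    simp only [hex, enorm_zero, tsum_zero, zero_le]

/-- `P_j f` is integrable, with Fourier transform `φ(2^{-j} ξ) 𝓕 f(ξ)`. -/
theorem integrable_lpProj_and_fourier_lpProj (hφ : IsLittlewoodPaley φ) {f : Plane → ℂ}
    (hf : ContDiff ℝ ∞ f) (hfc : HasCompactSupport f) (j : ℤ) :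
    Integrable (lpProj φ j f) ∧
      𝓕 (lpProj φ j f) = fun ξ => (φ ((2 : ℝ) ^ (-j) • ξ) : ℂ) * 𝓕 f ξ := by
  have hF : ContDiff ℝ ∞ (𝓕 f) := by
    have := (𝓕 (hfc.toSchwartzMap hf)).smooth ⊤
    rwa [SchwartzMap.fourier_coe] at this
  have hs : ContDiff ℝ ∞ fun ξ : Plane => (φ ((2 : ℝ) ^ (-j) • ξ) : ℂ) :=
    Complex.ofRealCLM.contDiff.comp (hφ.smooth.comp (contDiff_const_smul _))
  have hsc : HasCompactSupport fun ξ : Plane => (φ ((2 : ℝ) ^ (-j) • ξ) : ℂ) :=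
    (hφ.hasCompactSupport.comp_smul (by positivity)).comp_left (g := ((↑) : ℝ → ℂ)) rfl
  set G : SchwartzMap Plane ℂ := (hsc.mul_right (f' := 𝓕 f)).toSchwartzMap (hs.mul hF) with hG
  have hGc : (G : Plane → ℂ) = fun ξ => (φ ((2 : ℝ) ^ (-j) • ξ) : ℂ) * 𝓕 f ξ := rfl
  have e : lpProj φ j f = (𝓕⁻ G : SchwartzMap Plane ℂ) := by
    rw [SchwartzMap.fourierInv_coe]
    rfl
  rw [e]
  refine ⟨(𝓕⁻ G).integrable, ?_⟩
  rw [← SchwartzMap.fourier_coe, FourierTransform.fourier_fourierInv_eq]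
  exact hGc

/-- Finite overlap and integrability of `𝓕 f` justify exchanging sum and integral; the partition of
unity fails only at the origin, a null set. -/
theorem rieszSemigroup_eq_tsum (hφ : IsLittlewoodPaley φ) {f : Plane → ℂ}
    (hf : ContDiff ℝ ∞ f) (hfc : HasCompactSupport f) (t : ℝ) (x : Plane) :
    rieszSemigroup t f x = ∑' j : ℤ, rieszSemigroup t (lpProj φ j f) x := by
  have hFi : Integrable (𝓕 f) := by
    have := (𝓕 (hfc.toSchwartzMap hf)).integrable (μ := volume)
    rwa [SchwartzMap.fourier_coe] at this
  set w : Plane → ℂ := fun ξ =>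
    Complex.exp ((2 * Real.pi * inner ℝ ξ x : ℝ) * Complex.I) * Complex.exp (t * rieszSymbol ξ)
    with hw
  have hwm : Measurable w := Measurable.mul (by fun_prop) (measurable_exp_rieszSymbol t)
  have hwn : ∀ ξ, ‖w ξ‖ₑ = 1 := fun ξ => by
    rw [← ofReal_norm, hw, norm_mul, Complex.norm_exp_ofReal_mul_I, norm_exp_rieszSymbol, one_mul,
      ENNReal.ofReal_one]
  have hj : ∀ j, rieszSemigroup t (lpProj φ j f) x
      = ∫ ξ, (φ ((2 : ℝ) ^ (-j) • ξ) : ℂ) * (w ξ * 𝓕 f ξ) := by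
    intro j
    unfold rieszSemigroup
    rw [multiplierOp, (hφ.integrable_lpProj_and_fourier_lpProj hf hfc j).2, Real.fourierInv_eq']
    congr 1
    ext ξ
    simp only [hw, smul_eq_mul]
    ring
  simp_rw [hj]
  rw [← integral_tsum]
  · unfold rieszSemigroup
    rw [multiplierOp, Real.fourierInv_eq']
    refine integral_congr_ae ?_
    filter_upwards [Measure.ae_ne volume (0 : Plane)] with ξ hξ
    rw [tsum_mul_right, ← Complex.ofReal_tsum, hφ.sum_eq_one ξ hξ]
    simp only [hw, smul_eq_mul]
    push_cast
    ring
  · intro j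
    refine AEStronglyMeasurable.mul ?_ (hwm.aestronglyMeasurable.mul hFi.aestronglyMeasurable)
    refine Continuous.aestronglyMeasurable ?_
    exact Complex.continuous_ofReal.comp (hφ.smooth.continuous.comp (continuous_const_smul _))
  · obtain ⟨M, hM, hle⟩ := hφ.exists_tsum_enorm_le
    have hen : ∀ (j : ℤ) ξ, ‖(φ ((2 : ℝ) ^ (-j) • ξ) : ℂ) * (w ξ * 𝓕 f ξ)‖ₑ
        = ‖φ ((2 : ℝ) ^ (-j) • ξ)‖ₑ * ‖𝓕 f ξ‖ₑ := fun j ξ => by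
      rw [enorm_mul, enorm_mul, hwn, one_mul, ← ofReal_norm, Complex.norm_real, ofReal_norm]
    simp_rw [hen]
    rw [← lintegral_tsum]
    · simp_rw [ENNReal.tsum_mul_right]
      refine ne_top_of_le_ne_top ?_ (lintegral_mono fun ξ => mul_le_mul_left (hle ξ) _)
      rw [lintegral_const_mul' _ _ hM]
      exact ENNReal.mul_ne_top hM hFi.2.ne
    · intro j
      refine AEMeasurable.mul ?_ hFi.aestronglyMeasurable.enorm
      exact ((hφ.smooth.continuous.comp (continuous_const_smul _)).enorm).aemeasurable

end IsLittlewoodPaley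

/-! ### Summation over dyadic pieces -/

theorem besovNorm_one_one (φ : Plane → ℝ) (s : ℝ) (f : Plane → ℂ) :
    besovNorm φ s 1 1 f
      = ∑' j : ℤ, ENNReal.ofReal ((2 : ℝ) ^ ((j : ℝ) * s)) * eLpNorm (lpProj φ j f) 1 volume := by
  rw [besovNorm, eLpNorm_one_eq_lintegral_enorm, lintegral_count]
  rfl

theorem proposition2p1 (φ : Plane → ℝ) (hφ : IsLittlewoodPaley φ) :
    ∃ C : ℝ, 0 < C ∧
      ∀ f : Plane → ℂ, ContDiff ℝ ∞ f → HasCompactSupport f →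
        ∀ t : ℝ, 0 < t →
          MeasureTheory.eLpNorm (rieszSemigroup t f) ∞ MeasureTheory.volume
            ≤ ENNReal.ofReal (C * t ^ (-(1 / 2) : ℝ)) * besovNorm φ 2 1 1 f := by
  obtain ⟨a, b, ha, hab⟩ := hφ.annulus
  -- The maximum with `1` makes the radius `β 2^j` positive without examining `b`.
  set β : ℝ := max b 1 with hβ
  have hβ0 : 0 < β := lt_max_of_lt_right one_pos
  refine ⟨160 * β ^ 2, by positivity, fun f hf hfc t ht => ?_⟩
  rw [eLpNorm_exponent_top]
  refine eLpNormEssSup_le_of_ae_enorm_bound (.of_forall fun x => ?_)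
  rw [hφ.rieszSemigroup_eq_tsum hf hfc, besovNorm_one_one, ← ENNReal.tsum_mul_left]
  refine enorm_tsum_le_tsum_enorm.trans (ENNReal.tsum_le_tsum fun j => ?_)
  obtain ⟨hint, hfour⟩ := hφ.integrable_lpProj_and_fourier_lpProj hf hfc j
  have h2j : (0 : ℝ) < 2 ^ j := by positivity
  have hsupp : ∀ ξ, 𝓕 (lpProj φ j f) ξ ≠ 0 → ‖ξ‖ ≤ β * 2 ^ j := by
    intro ξ hξ
    rw [hfour] at hξ
    have h1 := (hab _ (Complex.ofReal_ne_zero.1 (left_ne_zero_of_mul hξ))).2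
    rw [IsLittlewoodPaley.norm_smul_two_zpow, zpow_neg, inv_mul_le_iff₀ h2j] at h1
    refine h1.trans ?_
    rw [mul_comm]
    gcongr
    exact le_max_left _ _
  have hb := norm_rieszSemigroup_le_of_fourier_support (by positivity) ht hint hsupp x
  have hpow : (2 : ℝ) ^ ((j : ℝ) * 2) = (2 ^ j) ^ 2 := by
    rw [Real.rpow_mul two_pos.le, Real.rpow_intCast, Real.rpow_two]
  rw [eLpNorm_one_eq_lintegral_enorm, ← ofReal_integral_norm_eq_lintegral_enorm hint, hpow,
    ← ENNReal.ofReal_mul (by positivity), ← ENNReal.ofReal_mul (by positivity), ← ofReal_norm]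
  refine ENNReal.ofReal_le_ofReal (hb.trans (le_of_eq ?_))
  ring
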